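/- Let $\mathbb{H}=\{z\in\mathbb{C}:\operatorname{Im}(z)>0\}$ be the complex upper half-plane and let $j:\mathbb{H}\to\mathbb{C}$ be the modular $j$-function, i.e. the unique holomorphic function on $\mathbb{H}$ that is invariant under the action of $\mathrm{SL}_2(\mathbb{Z})$ by linear fractional transformations and has a Fourier expansion of the form $j(z)=q^{-1}+744+\sum_{k\ge 1}a_kq^k$ with $q=e^{2\pi i z}$ and $a_k\in\mathbb{C}$ (equivalently, $j=E_4^3/\Delta$). Let $j'$ and $j''$ be its first and second derivatives with respect to $z$. **Theorem.** For every polynomial $F\in\mathbb{C}[X,Y_0,Y_1,Y_2]\setminus\mathbb{C}[X]$, the equation $$F(z,j(z),j'(z),j''(z))=0$$ has infinitely many solutions $z\in\mathbb{H}$. -/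

import Mathlib

/-- Klein's modular function `j = E₄³ / Δ` on the upper half-plane, with `E₄ = 1 + 240 q + ⋯` the
normalised level one Eisenstein series of weight 4 and `Δ = q ∏ (1 - qⁿ)²⁴` the modular
discriminant. (`Δ` has no zero.) It is normalised as `j = q⁻¹ + 744 + ⋯`, `q = exp (2 π i z)`. -/
noncomputable def modularJ (z : UpperHalfPlane) : ℂ :=
  ModularForm.E₄ z ^ 3 / ModularForm.discriminant z

/-- The complex derivative of order `n` of the modular `j`-function, as a function on the upper
half-plane. To differentiate on `ℂ`, `j` is extended to `ℂ` through `UpperHalfPlane.ofComplex`,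
which is the identity on the (open) upper half-plane, so the extension does not matter. -/
noncomputable def modularJDeriv (n : ℕ) (z : UpperHalfPlane) : ℂ :=
  iteratedDeriv n (fun w : ℂ => modularJ (UpperHalfPlane.ofComplex w)) (z : ℂ)

/-!
Write `γ` for the matrix `T ^ n * (1, 0; c, 1)`, so that `γ z = n + z / (c z + 1)`.
Differentiating `j (γ z) = j z` shows that `j' (γ z) = (c z + 1)² j'` and
`j'' (γ z) = (c z + 1)⁴ j'' + 2 c (c z + 1)³ j'`, with the derivatives on the right taken at `z`. Give `Y₁` and `Y₂` the
weights `2` and `4`, let `w` be the highest weight that occurs in `F`, and let `P` be the part of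
`F` of weight `w`. Dividing `F` at `γ z` by `c ^ w` gives a function of `t = 1 / c` and `z` which
extends continuously to `t = 0` (`eval_translatedLower_smul`), with limit
`G z = P (n, j, z² j', z⁴ j'' + 2 z³ j')`.

If `G` has a zero and does not vanish identically, Hurwitz's theorem
(`eventually_exists_zero_of_isolated_zero`) yields, for every large `c`, a zero near that of `G`.
Its image under `γ` solves the equation, and the imaginary part of this image tends to `0` as
`c → ∞`, so infinitely many solutions arise.

A zero of `G` is easy to find (`exists_zero_and_ne_zero`). For `w > 0` it is `ρ`: there `j` has a
zero of order at least three, so that `j'` and `j''` vanish. For `w = 0` only `X` and `Y₀` occur in `F`, and `j` is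
surjective (`modularJ_surjective`). That `G` is not identically zero for some `n` follows from the
period of `j`: under `z ↦ z + k` only the explicit powers of `z` change, which, together with the
homogeneity of `P`, makes the arguments of `P` independent enough to force `P = 0` otherwise
(`eq_zero_of_eval_rescaledPoint`).
-/

open UpperHalfPlane ModularForm Filter Topology MatrixGroups Manifold

/-! ### Invariance and surjectivity of `j` -/

theorem E₄_smul (γ : SL(2, ℤ)) (z : ℍ) : E₄ (γ • z) = denom γ z ^ 4 * E₄ z :=
  SlashInvariantForm.slash_action_eqn'' E₄ (MonoidHom.mem_range.mpr ⟨γ, rfl⟩) z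

theorem discriminant_smul (γ : SL(2, ℤ)) (z : ℍ) :
    discriminant (γ • z) = denom γ z ^ 12 * discriminant z :=
  SlashInvariantForm.slash_action_eqn'' CuspForm.discriminant (MonoidHom.mem_range.mpr ⟨γ, rfl⟩) z

theorem modularJ_smul (γ : SL(2, ℤ)) (z : ℍ) : modularJ (γ • z) = modularJ z := by
  have h := denom_ne_zero (γ : GL (Fin 2) ℝ) z
  rw [modularJ, modularJ, E₄_smul, discriminant_smul]
  field_simp

theorem mdifferentiable_modularJ : MDiff modularJ :=
  (E₄.holo'.pow 3).div CuspForm.discriminant.holo' discriminant_ne_zero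

theorem tendsto_E₄_atImInfty : Tendsto E₄ atImInfty (𝓝 1) := by
  have hanal := ModularFormClass.analyticAt_cuspFunction_zero E₄ one_pos one_mem_strictPeriods_SL
  have hper := SlashInvariantFormClass.periodic_comp_ofComplex E₄ one_mem_strictPeriods_SL
  have h1 : cuspFunction 1 E₄ 0 = 1 := by
    rw [cuspFunction_apply_zero one_pos hanal hper, ← qExpansion_coeff_zero one_pos hanal hper]
    exact EisensteinSeries.E_qExpansion_coeff_zero _ ⟨2, rfl⟩
  rw [← h1]
  exact (hanal.continuousAt.tendsto.comp (qParam_tendsto_atImInfty one_pos)).congr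
    (fun τ ↦ SlashInvariantFormClass.eq_cuspFunction E₄ τ one_mem_strictPeriods_SL one_ne_zero)

/-- If `j` omitted the value `a`, then `1 / (j - a) = Δ / (E₄³ - a Δ)` would be a modular form of
weight zero that vanishes at the cusp; such a form is constant, hence zero. -/
theorem modularJ_surjective : Function.Surjective modularJ := by
  intro a
  by_contra! h
  have h0 (z : ℍ) : modularJ z - a ≠ 0 := sub_ne_zero.mpr (h z)
  have hinf : IsZeroAtImInfty fun z : ℍ ↦ (modularJ z - a)⁻¹ := by
    have hΔ : Tendsto discriminant atImInfty (𝓝 0) := discriminant_isZeroAtImInfty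
    have : Tendsto (fun z ↦ discriminant z / (E₄ z ^ 3 - a * discriminant z)) atImInfty
        (𝓝 (0 / (1 ^ 3 - a * 0))) :=
      hΔ.div ((tendsto_E₄_atImInfty.pow 3).sub (hΔ.const_mul a)) (by simp)
    rw [zero_div] at this
    refine this.congr fun z ↦ ?_
    rw [modularJ, div_sub' (discriminant_ne_zero z), inv_div, mul_comm a]
  have hslash (γ : SL(2, ℤ)) : (fun z : ℍ ↦ (modularJ z - a)⁻¹) ∣[(0 : ℤ)] γ =
      fun z : ℍ ↦ (modularJ z - a)⁻¹ := by
    ext z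
    rw [SL_slash_apply, modularJ_smul, neg_zero, zpow_zero, mul_one]
  let φ : ModularForm 𝒮ℒ 0 :=
    { toFun z := (modularJ z - a)⁻¹
      slash_action_eq' := fun _ ⟨γ, hγ⟩ ↦ hγ ▸ hslash γ
      holo' := by
        have h1 := (mdifferentiable_const (c := (1 : ℂ))).div
          (mdifferentiable_modularJ.sub (mdifferentiable_const (c := a))) h0
        have h2 : (fun z : ℍ ↦ (modularJ z - a)⁻¹) = (fun _ ↦ 1) / (modularJ - fun _ ↦ a) := by
          ext z
          simp
        exact (congrArg (fun f : ℍ → ℂ ↦ MDiff f) h2).mpr h1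
      bdd_at_cusps' {c} hc := by
        rw [Subgroup.IsArithmetic.isCusp_iff_isCusp_SL2Z] at hc
        rw [OnePoint.isBoundedAt_iff_forall_SL2Z hc]
        intro γ _
        rw [hslash γ]
        exact hinf.isBoundedAtImInfty }
  obtain ⟨c, hc⟩ := ModularFormClass.levelOne_weight_zero_const φ
  have hc' (z : ℍ) : (modularJ z - a)⁻¹ = c := congrFun hc z
  simp only [IsZeroAtImInfty, ZeroAtFilter, hc'] at hinf
  have : c = 0 := tendsto_nhds_unique tendsto_const_nhds hinf
  exact inv_ne_zero (h0 I) ((hc' I).trans this)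


/-! ### The derivatives of `j` -/

/-- `j` as a function on `ℂ`, the function that `modularJDeriv` differentiates; its values off the
upper half-plane are irrelevant. -/
noncomputable def extJ (w : ℂ) : ℂ := modularJ (ofComplex w)

theorem modularJDeriv_one (z : ℍ) : modularJDeriv 1 z = deriv extJ z := by
  rw [modularJDeriv, iteratedDeriv_one]; rfl

theorem modularJDeriv_two (z : ℍ) : modularJDeriv 2 z = deriv (deriv extJ) z := by
  rw [modularJDeriv, iteratedDeriv_succ, iteratedDeriv_one]; rfl

theorem analyticOnNhd_extJ : AnalyticOnNhd ℂ extJ upperHalfPlaneSet :=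
  (UpperHalfPlane.mdifferentiable_iff.mp mdifferentiable_modularJ).analyticOnNhd
    isOpen_upperHalfPlaneSet

/-- `S ρ = T ρ`, but the automorphy factors of weight four there are `ρ⁴ ≠ 1` and `1`. -/
theorem E₄_ρ : E₄ ρ = 0 := by
  have h : ModularGroup.S • ρ = ModularGroup.T • ρ := by
    rw [UpperHalfPlane.ext_iff, modular_S_smul, modular_T_smul, UpperHalfPlane.coe_mk,
      coe_vadd, ← mul_one (_ : ℂ)⁻¹, inv_mul_eq_iff_eq_mul₀ (neg_ne_zero.mpr ρ.ne_zero)]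
    grind [ρ_sq, Complex.ofReal_one]
  have hS := E₄_smul ModularGroup.S ρ
  have hT := E₄_smul ModularGroup.T ρ
  rw [ModularGroup.denom_S] at hS
  have hd : denom (ModularGroup.T : GL (Fin 2) ℝ) ρ = 1 := by
    rw [ModularGroup.denom_apply]; simp [ModularGroup.T]
  rw [hd, one_pow, one_mul, ← h, hS] at hT
  have h4 : (ρ : ℂ) ^ 4 ≠ 1 := by
    intro h4
    have h1 : (ρ : ℂ) = 1 := by grind [ρ_sq]
    have := ρ.im_pos
    rw [← coe_im, h1] at this
    simp at this
  by_contra h0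
  exact h4 (mul_right_cancel₀ h0 (hT.trans (one_mul _).symm))

/-- `E₄` vanishes at `ρ`, so `j = E₄³ / Δ` has a zero of order at least three there. -/
theorem modularJDeriv_ρ : modularJDeriv 1 ρ = 0 ∧ modularJDeriv 2 ρ = 0 := by
  have he : AnalyticOnNhd ℂ (E₄ ∘ ofComplex) upperHalfPlaneSet :=
    (UpperHalfPlane.mdifferentiable_iff.mp E₄.holo').analyticOnNhd isOpen_upperHalfPlaneSet
  have hd : AnalyticOnNhd ℂ (discriminant ∘ ofComplex) upperHalfPlaneSet :=
    (UpperHalfPlane.mdifferentiable_iff.mp CuspForm.discriminant.holo').analyticOnNhd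
      isOpen_upperHalfPlaneSet
  set e := E₄ ∘ ofComplex with he'
  set d := discriminant ∘ ofComplex
  have h0 : e ρ = 0 := by rw [he', Function.comp_apply, ofComplex_apply, E₄_ρ]
  have hd0 (w : ℂ) : d w ≠ 0 := discriminant_ne_zero _
  have hJ : extJ = fun w ↦ e w ^ 3 / d w := rfl
  have h1 : ∀ w ∈ upperHalfPlaneSet, deriv extJ w =
      e w ^ 2 * ((3 * deriv e w * d w - e w * deriv d w) / d w ^ 2) := by
    intro w hw
    rw [hJ]
    refine (((he w hw).differentiableAt.hasDerivAt.fun_pow 3).fun_div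
      (hd w hw).differentiableAt.hasDerivAt (hd0 w)).deriv.trans ?_
    push_cast
    ring
  refine ⟨by rw [modularJDeriv_one, h1 _ ρ.im_pos, h0]; simp, ?_⟩
  have hev : deriv extJ =ᶠ[𝓝 (ρ : ℂ)] fun w ↦
      e w ^ 2 * ((3 * deriv e w * d w - e w * deriv d w) / d w ^ 2) :=
    Filter.eventually_of_mem (isOpen_upperHalfPlaneSet.mem_nhds ρ.im_pos) h1
  rw [modularJDeriv_two, hev.deriv_eq]
  have hea := he ρ ρ.im_pos
  have hda := hd ρ ρ.im_pos
  have hk : AnalyticAt ℂ (fun w ↦ (3 * deriv e w * d w - e w * deriv d w) / d w ^ 2) ρ :=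
    (((analyticAt_const.mul hea.deriv).mul hda).sub (hea.mul hda.deriv)).div (hda.pow 2)
      (pow_ne_zero 2 (hd0 _))
  refine ((hea.differentiableAt.hasDerivAt.fun_pow 2).fun_mul
    hk.differentiableAt.hasDerivAt).deriv.trans ?_
  simp [h0]

theorem hasDerivAt_SL_smul (γ : SL(2, ℤ)) (z : ℍ) :
    HasDerivAt (fun w : ℂ ↦ ((γ • ofComplex w : ℍ) : ℂ)) (1 / denom γ z ^ 2) z := by
  have hdet : (γ : GL (Fin 2) ℝ).val.det = 1 := Matrix.SpecialLinearGroup.det_coe _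
  have := (hasStrictDerivAt_smul (g := (γ : GL (Fin 2) ℝ))
    (by rw [hdet]; exact one_pos) z).hasDerivAt
  rwa [hdet, Complex.ofReal_one] at this

theorem deriv_extJ_smul (γ : SL(2, ℤ)) (z : ℍ) :
    deriv extJ ↑(γ • z) = denom γ z ^ 2 * deriv extJ z := by
  have hJ : HasDerivAt extJ (deriv extJ ↑(γ • z)) ↑(γ • ofComplex (z : ℂ)) := by
    rw [ofComplex_apply]
    exact (analyticOnNhd_extJ _ (γ • z).im_pos).differentiableAt.hasDerivAt
  have h := (hJ.comp (z : ℂ) (hasDerivAt_SL_smul γ z)).deriv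
  have hcomp : (extJ ∘ fun w ↦ ((γ • ofComplex w : ℍ) : ℂ)) = extJ := by
    ext w
    rw [Function.comp_apply, extJ, ofComplex_apply, modularJ_smul, extJ]
  have hdn := denom_ne_zero (γ : GL (Fin 2) ℝ) z
  rw [hcomp] at h
  rw [h, mul_left_comm, mul_one_div_cancel (pow_ne_zero 2 hdn), mul_one]

theorem deriv_deriv_extJ_smul (γ : SL(2, ℤ)) (z : ℍ) :
    deriv (deriv extJ) ↑(γ • z) =
      denom γ z ^ 4 * deriv (deriv extJ) z + 2 * γ 1 0 * denom γ z ^ 3 * deriv extJ z := by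
  have hJ : HasDerivAt (deriv extJ) (deriv (deriv extJ) ↑(γ • z)) ↑(γ • ofComplex (z : ℂ)) := by
    rw [ofComplex_apply]
    exact (analyticOnNhd_extJ _ (γ • z).im_pos).deriv.differentiableAt.hasDerivAt
  have h := (hJ.comp (z : ℂ) (hasDerivAt_SL_smul γ z)).deriv
  have hcomp : (deriv extJ ∘ fun w ↦ ((γ • ofComplex w : ℍ) : ℂ)) =ᶠ[𝓝 (z : ℂ)]
      fun w ↦ denom γ w ^ (2 : ℤ) * deriv extJ w := by
    filter_upwards [isOpen_upperHalfPlaneSet.mem_nhds z.im_pos] with w hw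
    rw [Function.comp_apply, deriv_extJ_smul, ofComplex_apply_of_im_pos hw]
    norm_cast
  rw [hcomp.deriv_eq, ((hasDerivAt_denom_zpow (γ : GL (Fin 2) ℝ) 2 z).fun_mul
    (analyticOnNhd_extJ _ z.im_pos).deriv.differentiableAt.hasDerivAt).deriv] at h
  have hdn := denom_ne_zero (γ : GL (Fin 2) ℝ) z
  have hc : (((γ : GL (Fin 2) ℝ) 1 0 : ℝ) : ℂ) = γ 1 0 := rfl
  rw [hc] at h
  generalize deriv (deriv extJ) ↑(γ • z) = A at *
  generalize ((γ 1 0 : ℤ) : ℂ) = c at *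
  generalize denom (γ : GL (Fin 2) ℝ) z = D at *
  norm_num at h
  norm_cast at h
  field_simp at h
  rw [← h]
  ring

/-! ### Weighted leading parts of polynomials -/

namespace MvPolynomial

section Weighted
variable {σ : Type*}

theorem prod_mul_pow_weight [Fintype σ] (W : σ → ℕ) (c : ℂ) (x : σ → ℂ) (m : σ →₀ ℕ) :
    ∏ i, (c ^ W i * x i) ^ m i = c ^ Finsupp.weight W m * ∏ i, x i ^ m i := by
  rw [Finsupp.weight_apply, Finsupp.sum_fintype _ _ (by simp), ← Finset.prod_pow_eq_pow_sum,
    ← Finset.prod_mul_distrib]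
  refine Finset.prod_congr rfl fun i _ ↦ ?_
  rw [mul_pow, ← pow_mul, smul_eq_mul, mul_comm (W i)]

theorem IsWeightedHomogeneous.eval_pow_mul [Fintype σ] {W : σ → ℕ} {n : ℕ} {P : MvPolynomial σ ℂ}
    (hP : P.IsWeightedHomogeneous W n) (c : ℂ) (x : σ → ℂ) :
    eval (fun i ↦ c ^ W i * x i) P = c ^ n * eval x P := by
  rw [eval_eq', eval_eq', Finset.mul_sum]
  refine Finset.sum_congr rfl fun m hm ↦ ?_
  rw [prod_mul_pow_weight, hP (mem_support_iff.mp hm)]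
  ring

/-- The leading part of `F` for the weights `W`: the sum of its terms of highest weight. -/
noncomputable def leadingPart (W : σ → ℕ) (F : MvPolynomial σ ℂ) : MvPolynomial σ ℂ :=
  weightedHomogeneousComponent W (F.weightedTotalDegree W) F

/-- The weighted homogenization of `F`, evaluated at `x`: the term of `F` of weight `k` is
multiplied by `t ^ (w - k)`, where `w` is the highest weight that occurs. -/
noncomputable def homogEval [Fintype σ] (W : σ → ℕ) (F : MvPolynomial σ ℂ) (t : ℂ)
    (x : σ → ℂ) : ℂ :=
  ∑ m ∈ F.support,
    F.coeff m * t ^ (F.weightedTotalDegree W - Finsupp.weight W m) * ∏ i, x i ^ m i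

theorem leadingPart_isWeightedHomogeneous (W : σ → ℕ) (F : MvPolynomial σ ℂ) :
    (leadingPart W F).IsWeightedHomogeneous W (F.weightedTotalDegree W) :=
  weightedHomogeneousComponent_isWeightedHomogeneous (w := W) _ _

theorem leadingPart_ne_zero (W : σ → ℕ) {F : MvPolynomial σ ℂ} (hF : F ≠ 0) :
    leadingPart W F ≠ 0 := by
  obtain ⟨m, hm, hmax⟩ := F.support.exists_mem_eq_sup (support_nonempty.mpr hF)
    (fun m ↦ Finsupp.weight W m)
  intro h
  have := congrArg (coeff m) h
  rw [leadingPart, coeff_weightedHomogeneousComponent, if_pos (by exact hmax.symm),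
    coeff_zero] at this
  exact mem_support_iff.mp hm this

theorem homogEval_zero [Fintype σ] (W : σ → ℕ) (F : MvPolynomial σ ℂ) (x : σ → ℂ) :
    homogEval W F 0 x = eval x (leadingPart W F) := by
  rw [eval_eq', homogEval, leadingPart, support_weightedHomogeneousComponent, Finset.sum_filter]
  refine Finset.sum_congr rfl fun m hm ↦ ?_
  have hle := le_weightedTotalDegree W hm
  rw [coeff_weightedHomogeneousComponent]
  split_ifs with h
  · simp [h]
  · rw [zero_pow (by omega)]
    simp

/-- `homogEval` at `t = c⁻¹` is, up to a power of `c`, the value of `F` at the point rescaled by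
`c`; letting `c → ∞` isolates the leading part, by `homogEval_zero`. -/
theorem pow_mul_homogEval_inv [Fintype σ] (W : σ → ℕ) (F : MvPolynomial σ ℂ) {c : ℂ} (hc : c ≠ 0)
    (x : σ → ℂ) :
    c ^ F.weightedTotalDegree W * homogEval W F c⁻¹ x = eval (fun i ↦ c ^ W i * x i) F := by
  rw [eval_eq', homogEval, Finset.mul_sum]
  refine Finset.sum_congr rfl fun m hm ↦ ?_
  rw [prod_mul_pow_weight]
  obtain ⟨k, hk⟩ := Nat.exists_eq_add_of_le (le_weightedTotalDegree W hm)
  rw [hk, Nat.add_sub_cancel_left, pow_add, inv_pow]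
  field_simp

theorem leadingPart_eq_self {W : σ → ℕ} {F : MvPolynomial σ ℂ}
    (h : F.weightedTotalDegree W = 0) : leadingPart W F = F := by
  rw [leadingPart, h]
  exact weightedHomogeneousComponent_eq_self
    (isWeightedHomogeneous_zero_iff_weightedTotalDegree_eq_zero.mpr h)

end Weighted

theorem polynomial_eval_aeval {σ : Type*} (F : MvPolynomial σ ℂ) (g : σ → Polynomial ℂ) (u : ℂ) :
    (aeval g F).eval u = eval (fun i ↦ (g i).eval u) F := by
  have := comp_aeval_apply g (Polynomial.aeval u) F
  simpa [aeval_eq_eval, Polynomial.coe_aeval_eq_eval] using this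

theorem eval_aeval_self {σ : Type*} (F : MvPolynomial σ ℂ) (g : σ → MvPolynomial σ ℂ) (x : σ → ℂ) :
    eval x (aeval g F) = eval (fun i ↦ eval x (g i)) F := by
  have := comp_aeval_apply g (aeval x) F
  simpa [aeval_eq_eval] using this

/-- A polynomial in `X, Y₀` outside `ℂ[X]` stays non-constant in `Y₀` for some natural number
`X = n`, so it has a zero and a non-zero value there. -/
theorem exists_eval_eq_zero_and_ne_zero {F : MvPolynomial (Fin 4) ℂ}
    (hF : F ∉ supported ℂ ({0} : Set (Fin 4)))
    (h0 : ∀ x, eval x F = eval ![x 0, x 1, 0, 0] F) :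
    ∃ (n : ℕ) (a b : ℂ), eval ![(n : ℂ), a, 0, 0] F = 0 ∧ eval ![(n : ℂ), b, 0, 0] F ≠ 0 := by
  by_contra! h
  have hconst (n : ℕ) (u : ℂ) : eval ![(n : ℂ), u, 0, 0] F = eval ![(n : ℂ), 0, 0, 0] F := by
    set p : Polynomial ℂ := aeval ![Polynomial.C (n : ℂ), Polynomial.X, 0, 0] F
    have hp (u : ℂ) : p.eval u = eval ![(n : ℂ), u, 0, 0] F := by
      rw [polynomial_eval_aeval]
      congr 2
      ext i
      fin_cases i <;> simp
    rcases lt_or_ge 0 p.degree with hd | hd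
    · obtain ⟨a, ha⟩ := IsAlgClosed.exists_root p hd.ne'
      obtain ⟨b, hb⟩ := IsAlgClosed.exists_root (p - Polynomial.C 1)
        (by rw [Polynomial.degree_sub_C hd]; exact hd.ne')
      have hb' : p.eval b = 1 := by simpa [sub_eq_zero] using hb
      have := h n a b ((hp a).symm.trans ha)
      rw [← hp, hb'] at this
      exact absurd this one_ne_zero
    · rw [← hp, ← hp, Polynomial.eq_C_of_degree_le_zero hd, Polynomial.eval_C, Polynomial.eval_C]
  apply hF
  have hFQ : F = aeval ![X 0, 0, 0, 0] F := by
    refine funext_set (Fin.cons (Set.range ((↑) : ℕ → ℂ)) fun _ ↦ Set.univ) ?_ ?_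
    · intro i
      refine Fin.cases ?_ (fun _ ↦ ?_) i
      · exact Set.infinite_range_of_injective Nat.cast_injective
      · exact Set.infinite_univ
    · intro x hx
      obtain ⟨n, hn⟩ : ∃ n : ℕ, (n : ℂ) = x 0 := hx 0 (Set.mem_univ _)
      rw [eval_aeval_self, h0, ← hn, hconst]
      congr 2
      ext i
      fin_cases i <;> simp [hn]
  rw [hFQ]
  rw [aeval_def, eval₂_eq']
  refine Subalgebra.sum_mem _ fun m _ ↦ Subalgebra.mul_mem _ (Subalgebra.algebraMap_mem _ _)
    (Subalgebra.prod_mem _ fun i _ ↦ Subalgebra.pow_mem _ ?_ _)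
  fin_cases i
  · exact Algebra.subset_adjoin ⟨0, rfl, rfl⟩
  all_goals exact Subalgebra.zero_mem _

end MvPolynomial

/-! ### Persistence of zeros -/

/-- A form of Hurwitz's theorem: in a family of holomorphic functions `H t` depending continuously
on `t`, a zero of `H 0` persists nearby for small `t`, provided `H 0` does not vanish identically.
-/
theorem eventually_exists_zero_of_isolated_zero {U : Set ℂ} (hU : IsOpen U) (hUc : IsPreconnected U)
    {H : ℝ → ℂ → ℂ} (hcont : ContinuousOn (fun p : ℝ × ℂ ↦ H p.1 p.2) (Set.univ ×ˢ U))
    (hdiff : ∀ t, DifferentiableOn ℂ (H t) U) {z₀ z₁ : ℂ} (hz₀ : z₀ ∈ U) (hz₁ : z₁ ∈ U)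
    (h0 : H 0 z₀ = 0) (h1 : H 0 z₁ ≠ 0) {V : Set ℂ} (hV : V ∈ 𝓝 z₀) :
    ∀ᶠ t in 𝓝 0, ∃ z ∈ U ∩ V, H t z = 0 := by
  have han (t : ℝ) : AnalyticOnNhd ℂ (H t) U := (hdiff t).analyticOnNhd hU
  have hisol : ∀ᶠ z in 𝓝[≠] z₀, H 0 z ≠ 0 := by
    refine ((han 0) z₀ hz₀).eventually_eq_zero_or_eventually_ne_zero.resolve_left fun h ↦ h1 ?_
    exact (han 0).eqOn_zero_of_preconnected_of_eventuallyEq_zero hUc hz₀ h hz₁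
  obtain ⟨r, hr, hball⟩ := Metric.nhds_basis_closedBall.mem_iff.mp
    (Filter.inter_mem (Filter.inter_mem (hU.mem_nhds hz₀) hV) (eventually_nhdsWithin_iff.mp hisol))
  have hUV : Metric.closedBall z₀ r ⊆ U ∩ V := fun z hz ↦ (hball hz).1
  have hct (t : ℝ) {z : ℂ} (hz : z ∈ U) :
      ContinuousAt (fun p : ℝ × ℂ ↦ H p.1 p.2) (t, z) :=
    hcont.continuousAt ((isOpen_univ.prod hU).mem_nhds ⟨Set.mem_univ _, hz⟩)
  have hS : Metric.sphere z₀ r ⊆ Metric.closedBall z₀ r := Metric.sphere_subset_closedBall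
  have hSne : (Metric.sphere z₀ r).Nonempty := NormedSpace.sphere_nonempty.mpr hr.le
  obtain ⟨y, hy, hymin⟩ := (isCompact_sphere z₀ r).exists_isMinOn hSne
    (((han 0).continuousOn.mono fun z hz ↦ (hUV (hS hz)).1).norm)
  set ε := ‖H 0 y‖
  have hεpos : 0 < ε := norm_pos_iff.mpr ((hball (hS hy)).2 (Metric.ne_of_mem_sphere hy hr.ne'))
  have hsphere : ∀ᶠ t in 𝓝 (0 : ℝ), ∀ z ∈ Metric.sphere z₀ r, ε / 2 < ‖H t z‖ := by
    refine (isCompact_sphere z₀ r).eventually_forall_of_forall_eventually fun z hz ↦ ?_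
    refine ((hct 0 (hUV (hS hz)).1).norm).eventually (lt_mem_nhds ?_)
    have : ε ≤ ‖H 0 z‖ := hymin hz
    exact (half_lt_self hεpos).trans_le this
  have hcentre : ∀ᶠ t in 𝓝 (0 : ℝ), ‖H t z₀‖ < ε / 8 := by
    have : ContinuousAt (fun t : ℝ ↦ ‖H t z₀‖) 0 :=
      ((hct 0 hz₀).comp (f := fun t : ℝ ↦ (t, z₀)) (by fun_prop)).norm
    refine this.eventually (gt_mem_nhds ?_)
    simp only [h0, norm_zero]
    positivity
  filter_upwards [hsphere, hcentre] with t ht htc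
  have hlow : ∀ z ∈ Metric.sphere z₀ r, ε / 4 ≤ ‖H t z - H t z₀‖ := fun z hz ↦ by
    linarith [ht z hz, norm_sub_norm_le (H t z) (H t z₀)]
  have hfreq : ∃ᶠ z in 𝓝 z₀, H t z ≠ H t z₀ := by
    intro h
    have heq := (han t).eqOn_of_preconnected_of_eventuallyEq analyticOnNhd_const hUc hz₀
      (h.mono fun z hz ↦ not_not.mp hz) (hUV (hS hy)).1
    have := hlow y hy
    rw [heq, sub_self, norm_zero] at this
    linarith
  have hd : DiffContOnCl ℂ (H t) (Metric.ball z₀ r) :=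
    ((hdiff t).mono fun z hz ↦ (hUV (Metric.closure_ball_subset_closedBall hz)).1).diffContOnCl
  obtain ⟨z, hz, hz0⟩ := hd.ball_subset_image_closedBall hr hlow hfreq
    (show (0 : ℂ) ∈ Metric.ball (H t z₀) (ε / 4 / 2) by
      rw [mem_ball_iff_norm, zero_sub, norm_neg]; linarith)
  exact ⟨z, hUV hz, hz0⟩

/-! ### The matrices `T ^ n * (1, 0; c, 1)` and the limit function -/

/-- The matrix `T ^ n * (1, 0; c, 1)` of `SL(2, ℤ)`, which acts as `z ↦ n + z / (c z + 1)`. -/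
def translatedLower (n c : ℕ) : SL(2, ℤ) :=
  ⟨!![1 + n * c, n; c, 1], by rw [Matrix.det_fin_two_of]; ring⟩

theorem denom_translatedLower (n c : ℕ) (z : ℍ) : denom (translatedLower n c) z = c * z + 1 := by
  rw [ModularGroup.denom_apply]
  simp [translatedLower]

theorem coe_translatedLower_smul (n c : ℕ) (z : ℍ) :
    ((translatedLower n c • z : ℍ) : ℂ) = n + z / (c * z + 1) := by
  have h : (c * z + 1 : ℂ) ≠ 0 := denom_translatedLower n c z ▸ denom_ne_zero _ z
  rw [coe_specialLinearGroup_apply]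
  simp [translatedLower]
  field_simp
  ring

/-- The weights of `X, Y₀, Y₁, Y₂`: the powers of the lower left entry `c` by which `z`, `j`, `j'`
and `j''` grow under `translatedLower n c` as `c → ∞`. -/
def weights : Fin 4 → ℕ := ![0, 0, 2, 4]

/-- The values of `z, j, j', j''` at the image of `z` under `translatedLower n c`, divided by `c`
to the power of their weights and written in terms of `t = c⁻¹`. They extend continuously to
`t = 0`. -/
noncomputable def rescaledPoint (n : ℕ) (t z : ℂ) : Fin 4 → ℂ :=
  ![n + t * z / (z + t), extJ z, (z + t) ^ 2 * deriv extJ z,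
    (z + t) ^ 4 * deriv (deriv extJ) z + 2 * (z + t) ^ 3 * deriv extJ z]

theorem eval_translatedLower_smul (n : ℕ) {c : ℕ} (hc : c ≠ 0) (z : ℍ)
    (F : MvPolynomial (Fin 4) ℂ) :
    MvPolynomial.eval ![((translatedLower n c • z : ℍ) : ℂ), modularJ (translatedLower n c • z),
      modularJDeriv 1 (translatedLower n c • z), modularJDeriv 2 (translatedLower n c • z)] F =
    (c : ℂ) ^ F.weightedTotalDegree weights *
      F.homogEval weights (c : ℂ)⁻¹ (rescaledPoint n (c : ℂ)⁻¹ z) := by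
  have hc' : (c : ℂ) ≠ 0 := Nat.cast_ne_zero.mpr hc
  have hd : (c * z + 1 : ℂ) ≠ 0 := denom_translatedLower n c z ▸ denom_ne_zero _ z
  have h10 : (((translatedLower n c) 1 0 : ℤ) : ℂ) = c := by simp [translatedLower]
  have hz : (z + (c : ℂ)⁻¹ : ℂ) = (c * z + 1) / c := by field_simp
  rw [MvPolynomial.pow_mul_homogEval_inv _ _ hc', modularJ_smul, modularJDeriv_one,
    modularJDeriv_two, deriv_extJ_smul, deriv_deriv_extJ_smul, denom_translatedLower,
    coe_translatedLower_smul, h10]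
  congr 2
  ext i
  fin_cases i
  · simp [weights, rescaledPoint, hz]
    field_simp
  · simp [weights, rescaledPoint, extJ]
  · simp [weights, rescaledPoint, hz]
    field_simp
  · simp [weights, rescaledPoint, hz]
    field_simp

theorem exists_deriv_extJ_ne_zero : ∃ z : ℍ, deriv extJ z ≠ 0 := by
  by_contra! h
  obtain ⟨z, hz⟩ := modularJ_surjective 0
  obtain ⟨w, hw⟩ := modularJ_surjective 1
  have := isOpen_upperHalfPlaneSet.is_const_of_deriv_eq_zero
    (convex_halfSpace_im_gt 0).isPreconnected analyticOnNhd_extJ.differentiableOn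
    (fun x hx ↦ h ⟨x, hx⟩) z.im_pos w.im_pos
  rw [extJ, extJ, ofComplex_apply, ofComplex_apply, hz, hw] at this
  exact zero_ne_one this

theorem infinite_modularJ_image : (modularJ '' {z | deriv extJ z ≠ 0}).Infinite := by
  obtain ⟨z, hz⟩ := exists_deriv_extJ_ne_zero
  have ha := analyticOnNhd_extJ _ z.im_pos
  have hmap := ha.hasStrictDerivAt.map_nhds_eq hz
  have h1 : ∀ᶠ w in 𝓝 (z : ℂ), deriv extJ w ≠ 0 := ha.deriv.continuousAt.eventually_ne hz
  have h2 : extJ '' {w | deriv extJ w ≠ 0 ∧ w ∈ upperHalfPlaneSet} ∈ 𝓝 (extJ z) := by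
    rw [← hmap]
    exact image_mem_map (h1.and (isOpen_upperHalfPlaneSet.mem_nhds z.im_pos))
  refine (infinite_of_mem_nhds _ h2).mono ?_
  rintro _ ⟨w, ⟨hw, hw'⟩, rfl⟩
  exact ⟨⟨w, hw'⟩, hw, by rw [extJ, ofComplex_apply_of_im_pos hw']⟩

/-- Replacing `z` by `z + k` changes the point `rescaledPoint n 0 z` only through the explicit
powers of `z`, since `j` has period one. -/
theorem eval_translate {n : ℕ} {P : MvPolynomial (Fin 4) ℂ}
    (h : ∀ z : ℍ, MvPolynomial.eval (rescaledPoint n 0 z) P = 0) (z : ℍ) (k : ℕ) :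
    MvPolynomial.eval ![(n : ℂ), modularJ z, (z + k) ^ 2 * deriv extJ z,
      (z + k) ^ 4 * deriv (deriv extJ) z + 2 * (z + k) ^ 3 * deriv extJ z] P = 0 := by
  have := h (translatedLower k 0 • z)
  rw [rescaledPoint, deriv_extJ_smul, deriv_deriv_extJ_smul, denom_translatedLower,
    coe_translatedLower_smul, ← coe_translatedLower_smul, extJ, ofComplex_apply,
    modularJ_smul, coe_translatedLower_smul] at this
  rw [← this]
  congr 2
  ext i
  fin_cases i
  · simp
  · simp
  · simp [add_comm]
  · simp [translatedLower]; ring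

/-- A weighted homogeneous polynomial that vanishes on all curves `rescaledPoint n 0` is zero.
After scaling, replacing `z` by `z + k` moves only the last coordinate `j'' + 2 j' / (z + k)`,
which therefore becomes free; scaling by a square root then frees the third coordinate, too. -/
theorem eq_zero_of_eval_rescaledPoint {d : ℕ} {P : MvPolynomial (Fin 4) ℂ}
    (hP : P.IsWeightedHomogeneous weights d)
    (h : ∀ (n : ℕ) (z : ℍ), MvPolynomial.eval (rescaledPoint n 0 z) P = 0) : P = 0 := by
  have hscale (c a b u v : ℂ) : MvPolynomial.eval ![a, b, c ^ 2 * u, c ^ 4 * v] P =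
      c ^ d * MvPolynomial.eval ![a, b, u, v] P := by
    rw [← hP.eval_pow_mul]
    congr 2
    ext i
    fin_cases i <;> simp [weights]
  have h1 (n : ℕ) (z : ℍ) (hz : deriv extJ z ≠ 0) (u : ℂ) :
      MvPolynomial.eval ![(n : ℂ), modularJ z, deriv extJ z, u] P = 0 := by
    set p : Polynomial ℂ := MvPolynomial.aeval ![Polynomial.C (n : ℂ), Polynomial.C (modularJ z),
      Polynomial.C (deriv extJ z), Polynomial.X] P
    have hp (u : ℂ) : p.eval u = MvPolynomial.eval ![(n : ℂ), modularJ z, deriv extJ z, u] P := by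
      rw [MvPolynomial.polynomial_eval_aeval]
      congr 2
      ext i
      fin_cases i <;> simp
    rw [← hp]
    suffices p = 0 by rw [this, Polynomial.eval_zero]
    have hne (k : ℕ) : (z + k : ℂ) ≠ 0 := by
      intro h0
      have := congrArg Complex.im h0
      simp at this
      exact z.im_pos.ne' this
    refine Polynomial.eq_zero_of_infinite_isRoot _ (Set.infinite_of_injective_forall_mem
      (f := fun k : ℕ ↦ deriv (deriv extJ) z + 2 * deriv extJ z / (z + k)) ?_ fun k ↦ ?_)
    · intro k l hkl
      have h1 := hne k
      have h2 := hne l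
      have h3 : 2 * deriv extJ z / (z + k) = 2 * deriv extJ z / (z + l) := add_left_cancel hkl
      field_simp at h3
      exact_mod_cast (add_left_cancel h3).symm
    · have h2 := eval_translate (h n) z k
      have h3 := hne k
      rw [show (z + k : ℂ) ^ 4 * deriv (deriv extJ) z + 2 * (z + k : ℂ) ^ 3 * deriv extJ z =
        (z + k : ℂ) ^ 4 * (deriv (deriv extJ) z + 2 * deriv extJ z / (z + k)) by field_simp,
        hscale] at h2
      exact (hp _).trans ((mul_eq_zero.mp h2).resolve_left (pow_ne_zero _ h3))
  refine MvPolynomial.funext_set ![Set.range ((↑) : ℕ → ℂ), modularJ '' {z | deriv extJ z ≠ 0},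
    {0}ᶜ, Set.univ] ?_ ?_
  · intro i
    fin_cases i
    · exact Set.infinite_range_of_injective Nat.cast_injective
    · exact infinite_modularJ_image
    · exact (Set.finite_singleton 0).infinite_compl
    · exact Set.infinite_univ
  · intro x hx
    obtain ⟨n, hn⟩ : ∃ n : ℕ, (n : ℂ) = x 0 := hx 0 (Set.mem_univ _)
    obtain ⟨z, hz, hzx⟩ : x 1 ∈ modularJ '' {z | deriv extJ z ≠ 0} := hx 1 (Set.mem_univ _)
    have hx2 : x 2 ≠ 0 := hx 2 (Set.mem_univ _)
    obtain ⟨c, hc⟩ := IsAlgClosed.exists_pow_nat_eq (x 2 / deriv extJ z) two_pos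
    have hc0 : c ≠ 0 := by
      rintro rfl
      exact div_ne_zero hx2 hz (by rw [← hc]; simp)
    have := hscale c n (modularJ z) (deriv extJ z) (x 3 / c ^ 4)
    rw [h1 n z hz, mul_zero, hc, div_mul_cancel₀ _ hz, mul_div_cancel₀ _ (pow_ne_zero 4 hc0), hn,
      hzx] at this
    rw [map_zero, ← this]
    congr 2
    ext i
    fin_cases i <;> rfl

/-- The limit function at `t = 0` has a zero and is not identically zero, for a suitable `n`. If
the leading part of `F` has positive weight, the zero is `ρ`, where `j' = j'' = 0`; if it has
weight zero, then `F` involves only `X` and `Y₀`, and the surjectivity of `j` gives the zero. -/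
theorem exists_zero_and_ne_zero {F : MvPolynomial (Fin 4) ℂ}
    (hF : F ∉ MvPolynomial.supported ℂ ({0} : Set (Fin 4))) :
    ∃ n : ℕ, (∃ z : ℍ, F.homogEval weights 0 (rescaledPoint n 0 z) = 0) ∧
      ∃ z : ℍ, F.homogEval weights 0 (rescaledPoint n 0 z) ≠ 0 := by
  simp only [MvPolynomial.homogEval_zero]
  have hP := MvPolynomial.leadingPart_isWeightedHomogeneous weights F
  -- Homogeneity with the scaling factor `0`, which keeps the coordinates of weight zero.
  have hscale (x : Fin 4 → ℂ) : MvPolynomial.eval ![x 0, x 1, 0, 0] (F.leadingPart weights) =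
      0 ^ F.weightedTotalDegree weights * MvPolynomial.eval x (F.leadingPart weights) := by
    rw [← hP.eval_pow_mul]
    congr 2
    ext i
    fin_cases i <;> simp [weights]
  by_cases hw : F.weightedTotalDegree weights = 0
  · rw [MvPolynomial.leadingPart_eq_self hw] at hscale ⊢
    simp only [hw, pow_zero, one_mul] at hscale
    obtain ⟨n, a, b, ha, hb⟩ :=
      MvPolynomial.exists_eval_eq_zero_and_ne_zero hF fun x ↦ (hscale x).symm
    have key (z : ℍ) : MvPolynomial.eval (rescaledPoint n 0 z) F =
        MvPolynomial.eval ![(n : ℂ), modularJ z, 0, 0] F := by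
      rw [← hscale]
      simp [rescaledPoint, extJ]
    obtain ⟨z, rfl⟩ := modularJ_surjective a
    obtain ⟨z', rfl⟩ := modularJ_surjective b
    exact ⟨n, ⟨z, (key z).trans ha⟩, z', (key z').trans_ne hb⟩
  · have hF0 : F ≠ 0 := by
      rintro rfl
      exact hF (Subalgebra.zero_mem _)
    obtain ⟨n, z, hz⟩ : ∃ (n : ℕ) (z : ℍ),
        MvPolynomial.eval (rescaledPoint n 0 z) (F.leadingPart weights) ≠ 0 := by
      by_contra! h
      exact MvPolynomial.leadingPart_ne_zero weights hF0 (eq_zero_of_eval_rescaledPoint hP h)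
    refine ⟨n, ⟨ρ, ?_⟩, z, hz⟩
    have hj : deriv extJ ρ = 0 := (modularJDeriv_one ρ).symm.trans modularJDeriv_ρ.1
    have hj' : deriv (deriv extJ) ρ = 0 := (modularJDeriv_two ρ).symm.trans modularJDeriv_ρ.2
    have hpt : rescaledPoint n 0 ρ =
        ![rescaledPoint n 0 ρ 0, rescaledPoint n 0 ρ 1, 0, 0] := by
      ext i
      fin_cases i <;> simp [rescaledPoint, hj, hj']
    rw [hpt, hscale, zero_pow hw, zero_mul]

theorem add_ofReal_ne_zero {z : ℂ} (hz : z ∈ upperHalfPlaneSet) (t : ℝ) : z + t ≠ 0 := by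
  intro h
  have := congrArg Complex.im h
  simp at this
  exact hz.ne' this

theorem continuousOn_homogEval_rescaledPoint (F : MvPolynomial (Fin 4) ℂ) (n : ℕ) :
    ContinuousOn (fun p : ℝ × ℂ ↦ F.homogEval weights p.1 (rescaledPoint n p.1 p.2))
      (Set.univ ×ˢ upperHalfPlaneSet) := by
  have hs : Set.MapsTo (Prod.snd : ℝ × ℂ → ℂ) (Set.univ ×ˢ upperHalfPlaneSet)
    upperHalfPlaneSet := fun p hp ↦ hp.2
  have h0 := analyticOnNhd_extJ.continuousOn.comp continuousOn_snd hs
  have h1 := analyticOnNhd_extJ.deriv.continuousOn.comp continuousOn_snd hs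
  have h2 := analyticOnNhd_extJ.deriv.deriv.continuousOn.comp continuousOn_snd hs
  have ht : ContinuousOn (fun p : ℝ × ℂ ↦ (p.1 : ℂ)) (Set.univ ×ˢ upperHalfPlaneSet) := by fun_prop
  have hadd := (continuousOn_snd (α := ℝ) (β := ℂ) (s := Set.univ ×ˢ upperHalfPlaneSet)).add ht
  unfold MvPolynomial.homogEval
  refine continuousOn_finsetSum _ fun m _ ↦ (continuousOn_const.mul (ht.pow _)).mul
    (continuousOn_finsetProd _ fun i _ ↦ ContinuousOn.pow ?_ _)
  fin_cases i
  · exact continuousOn_const.add ((ht.mul continuousOn_snd).div hadd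
      fun p hp ↦ add_ofReal_ne_zero hp.2 p.1)
  · exact h0
  · exact (hadd.pow 2).mul h1
  · exact ((hadd.pow 4).mul h2).add ((continuousOn_const.mul (hadd.pow 3)).mul h1)

theorem differentiableOn_homogEval_rescaledPoint (F : MvPolynomial (Fin 4) ℂ) (n : ℕ) (t : ℝ) :
    DifferentiableOn ℂ (fun z ↦ F.homogEval weights t (rescaledPoint n t z)) upperHalfPlaneSet := by
  have h0 := analyticOnNhd_extJ.differentiableOn
  have h1 := analyticOnNhd_extJ.deriv.differentiableOn
  have h2 := analyticOnNhd_extJ.deriv.deriv.differentiableOn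
  have hadd : DifferentiableOn ℂ (fun z : ℂ ↦ z + t) upperHalfPlaneSet := by fun_prop
  unfold MvPolynomial.homogEval
  refine DifferentiableOn.fun_sum fun m _ ↦ (differentiableOn_const _).mul
    (DifferentiableOn.fun_finsetProd fun i _ ↦ DifferentiableOn.fun_pow ?_ _)
  fin_cases i
  · exact (differentiableOn_const _).add (((differentiableOn_const _).mul differentiableOn_id).div
      hadd fun z hz ↦ add_ofReal_ne_zero hz t)
  · exact h0
  · exact (hadd.pow 2).mul h1
  · exact ((hadd.pow 4).mul h2).add (((differentiableOn_const _).mul (hadd.pow 3)).mul h1)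

/-- The bound tends to `0` as `c → ∞`, so that the translates of points of a compact subset of `ℍ`
approach the real line. -/
theorem im_translatedLower_smul_le (n : ℕ) {c : ℕ} (hc : c ≠ 0) (z : ℍ) :
    (translatedLower n c • z).im ≤ (c : ℝ)⁻¹ ^ 2 * z.im⁻¹ := by
  have hz := z.im_pos
  have hc' : (0 : ℝ) < c := by positivity
  rw [ModularGroup.im_smul_eq_div_normSq, denom_translatedLower]
  have h : (c * z.im) ^ 2 ≤ Complex.normSq (c * z + 1) := by
    simp [Complex.normSq_apply]
    nlinarith [sq_nonneg (c * z.re + 1)]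
  calc z.im / Complex.normSq (c * z + 1) ≤ z.im / (c * z.im) ^ 2 := by gcongr
    _ = (c : ℝ)⁻¹ ^ 2 * z.im⁻¹ := by field_simp

/-- The variables `X, Y₀, Y₁, Y₂` are indexed by `0, 1, 2, 3 : Fin 4`, and
`MvPolynomial.supported ℂ {0}` is the subring `ℂ[X]` of `ℂ[X, Y₀, Y₁, Y₂]`. -/
theorem theorem1p1 (F : MvPolynomial (Fin 4) ℂ)
    (hF : F ∉ MvPolynomial.supported ℂ ({0} : Set (Fin 4))) :
    {z : UpperHalfPlane |
      MvPolynomial.eval ![(z : ℂ), modularJ z, modularJDeriv 1 z, modularJDeriv 2 z] F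
        = 0}.Infinite := by
  obtain ⟨n, ⟨z₀, h0⟩, z₁, h1⟩ := exists_zero_and_ne_zero hF
  have hpos := z₀.im_pos
  -- The limit function vanishes at `z₀`, so the rescaled function at `t = 1 / c` has a zero near
  -- `z₀` for all large `c`. The translates of these zeros are solutions, with imaginary parts
  -- tending to `0`.
  have hev (δ : ℝ) (hδ : 0 < δ) : ∃ z : ℍ, MvPolynomial.eval
      ![(z : ℂ), modularJ z, modularJDeriv 1 z, modularJDeriv 2 z] F = 0 ∧ z.im < δ := by
    have hzero := eventually_exists_zero_of_isolated_zero isOpen_upperHalfPlaneSet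
      (convex_halfSpace_im_gt 0).isPreconnected
      (H := fun t z ↦ F.homogEval weights t (rescaledPoint n t z))
      (continuousOn_homogEval_rescaledPoint F n) (differentiableOn_homogEval_rescaledPoint F n)
      z₀.im_pos z₁.im_pos (by simpa using h0) (by simpa using h1)
      (Complex.continuous_im.continuousAt.eventually (lt_mem_nhds (half_lt_self hpos)))
    have hsmall : ∀ᶠ t : ℝ in 𝓝 0, t ^ 2 * (z₀.im / 2)⁻¹ < δ := by
      have : ContinuousAt (fun t : ℝ ↦ t ^ 2 * (z₀.im / 2)⁻¹) 0 := by fun_prop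
      exact this.eventually (gt_mem_nhds (by simpa using hδ))
    obtain ⟨c, ⟨⟨z, ⟨hzU, hzV⟩, hz⟩, hc⟩, hcpos⟩ :=
      ((tendsto_inv_atTop_nhds_zero_nat.eventually (hzero.and hsmall)).and
        (eventually_gt_atTop 0)).exists
    lift z to ℍ using hzU
    refine ⟨translatedLower n c • z, ?_, ?_⟩
    · rw [eval_translatedLower_smul n hcpos.ne']
      push_cast at hz
      rw [hz, mul_zero]
    · refine ((im_translatedLower_smul_le n hcpos.ne' z).trans ?_).trans_lt hc
      have : z₀.im / 2 < z.im := hzV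
      gcongr
  intro hfin
  obtain ⟨z, hz, -⟩ := hev 1 one_pos
  obtain ⟨w, hw, hmin⟩ := Set.exists_min_image _ UpperHalfPlane.im hfin ⟨z, hz⟩
  obtain ⟨z', hz', hlt⟩ := hev w.im w.im_pos
  exact (hmin z' hz').not_gt hlt
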